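/- Let $f:\mathbb{R}^n\to\mathbb{R}$ be convex and differentiable with $\|\nabla f(u)-\nabla f(v)\|\le L_f\|u-v\|$ for all $u,v$ (with $L_f>0$), let $U\subseteq\mathbb{R}^n$ be closed, convex and bounded with diameter $D_U$, let $G\in\mathbb{R}^{m\times n}$ with spectral norm $\|G\|$ and $g\in\mathbb{R}^m$. Consider $$f^*=\min\{f(u): u\in U,\ Gu+g=0\},$$ and assume that an optimal solution exists and that there is an optimal Lagrange multiplier $x^*\in\mathbb{R}^m$, i.e. $\min_{u\in U}\{f(u)+\langle x^*,Gu+g\rangle\}=f^*$. A point $u\in U$ is called $\epsilon$-optimal if $f(u)-f^*\le\epsilon$ and $\|Gu+g\|\le\epsilon$. For $\rho,\mu\ge 0$ put $$\mathcal L_{\mu\rho}(u,x)=f(u)+\langle x,Gu+g\rangle+\tfrac{\rho}{2}\|Gu+g\|^2-\tfrac{\mu}{2}\|x\|^2,\qquad d_\rho(x)=\min_{u\in U}\mathcal L_{0\rho}(u,x),\qquad f_\mu(u)=\max_{x\in\mathbb{R}^m}\mathcal L_{\mu0}(u,x)\quad(\mu>0).$$ Fix $\rho>0$ and let $\mu_0=\frac4\rho$,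 $\tau_k=\frac{2}{k+3}$, $\delta_k=\frac{\epsilon}{2(k+3)}$. The IFAL$(\rho,\epsilon)$ method starts from $u^0\in U$, $x^0\in\mathbb{R}^m$ with $\Delta_0:=f_{\mu_0}(u^0)-d_\rho(x^0)\le\delta_0$ and performs, for $k=0,1,\dots$, $$\hat x^k=(1-\tau_k)x^k+\tfrac{\tau_k}{\mu_k}(Gu^k+g),\quad \text{find } \tilde u^k\in U \text{ with } \mathcal L_{0\rho}(\tilde u^k,\hat x^k)-d_\rho(\hat x^k)\le\delta_k,$$ $$u^{k+1}=(1-\tau_k)u^k+\tau_k\tilde u^k,\quad x^{k+1}=\hat x^k+\rho(G\tilde u^k+g),\quad \mu_{k+1}=(1-\tau_k)\mu_k.$$ Here $\tilde u^k$ is computed by Nesterov's optimal (accelerated projected gradient) method applied to $\varphi(u)=\mathcal L_{0\rho}(u,\hat x^k)$ over $U$ with $L=L_f+\rho\|G\|^2$: from an arbitrary $y_0=z_0\in U$ and $t_0=1$, $$y_{j+1}=\mathrm{proj}_U\big(z_j-\tfrac1L\nabla\varphi(z_j)\big),\quad t_{j+1}=\tfrac{1+\sqrt{1+4t_j^2}}2,\quad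 z_{j+1}=y_{j+1}+\tfrac{t_j-1}{t_{j+1}}(y_{j+1}-y_j),$$ stopped at the first $y_j$ that has the required accuracy $\delta_k$; this costs $j$ projections onto $U$. (1) For every $\epsilon>0$ with $\epsilon\le 24D_U^2(L_f+\rho\|G\|^2)$ (equivalently $2D_U\sqrt{(L_f+\rho\|G\|^2)/\delta_0}\ge1$) and all such starting points, every inner call terminates with the required accuracy, and there is an outer iteration $K$ such that $u^K$ is $\epsilon$-optimal and the total number of projections onto $U$ in the outer iterations $0,\dots,K$ is at most $$\left\lfloor\frac{16\,\gamma^{3/2}D_U\,[2(L_f+\rho\|G\|^2)]^{1/2}}{\epsilon^{5/4}}\right\rfloor,\qquad \gamma=\max\left\{\Big(\frac{\epsilon}{3}\Big)^{1/2},\Big(\frac{32}{\rho}\Big)^{1/2},\Big(\frac{8\|x^*\|}{\rho}+2\sqrt{\frac{4\epsilon}{3\rho}}\Big)^{1/2}\right\}.$$ (2) Consequently the total complexity is $O(\epsilon^{-5/4})$: for the fixed problem and fixed $\rho$ there is a constant $C$ such that for all sufficiently small $\epsilon>0$ and all such starting points there is $K$ such that $u^K$ is $\epsilon$-optimal and the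 outer iterations $0,\dots,K$ use at most $C\epsilon^{-5/4}$ projections onto $U$. -/

import Mathlib

open scoped Topology

/-- The data of the problem `min f(u)` subject to `u ∈ U`, `G u + g = 0`. -/
structure LinConstrProgram (n m : ℕ) where
  f : EuclideanSpace ℝ (Fin n) → ℝ
  U : Set (EuclideanSpace ℝ (Fin n))
  G : EuclideanSpace ℝ (Fin n) →L[ℝ] EuclideanSpace ℝ (Fin m)
  g : EuclideanSpace ℝ (Fin m)

/-- A Euclidean projection of `x` onto `S` (a nearest point; unique and existing for `S` nonempty,
closed and convex). -/
noncomputable def projOn {n : ℕ} (S : Set (EuclideanSpace ℝ (Fin n)))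
    (x : EuclideanSpace ℝ (Fin n)) : EuclideanSpace ℝ (Fin n) :=
  Classical.epsilon fun p => p ∈ S ∧ ∀ v ∈ S, ‖x - p‖ ≤ ‖x - v‖

theorem projOn_spec {n : ℕ} {S : Set (EuclideanSpace ℝ (Fin n))} (hne : S.Nonempty)
    (hcl : IsClosed S) (x : EuclideanSpace ℝ (Fin n)) :
    projOn S x ∈ S ∧ ∀ v ∈ S, ‖x - projOn S x‖ ≤ ‖x - v‖ := by
  obtain ⟨p, hp, hd⟩ := hcl.exists_infDist_eq_dist hne x
  refine Classical.epsilon_spec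
    (p := fun p => p ∈ S ∧ ∀ v ∈ S, ‖x - p‖ ≤ ‖x - v‖) ⟨p, hp, fun v hv => ?_⟩
  rw [← dist_eq_norm, ← dist_eq_norm, ← hd]
  exact Metric.infDist_le_dist_of_mem hv

/-- The step parameters `t₀ = 1`, `t_{j+1} = (1 + √(1 + 4 t_j²)) / 2` of Nesterov's optimal method;
`α_j = 1 / t_j` satisfies `α_{j+1}² = (1 - α_{j+1}) α_j²`. -/
noncomputable def nesterovParam : ℕ → ℝ
  | 0 => 1
  | j + 1 => (1 + √(1 + 4 * nesterovParam j ^ 2)) / 2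

/-- Nesterov's optimal (accelerated projected gradient) method for minimizing `φ` over `S`, with
Lipschitz constant `L` of the gradient and starting point `w`. The first component of the value at
`j` is the iterate `y_j`, the second one the extrapolated point. Each step uses one projection. -/
noncomputable def nesterovIter {n : ℕ} (φ : EuclideanSpace ℝ (Fin n) → ℝ)
    (S : Set (EuclideanSpace ℝ (Fin n))) (L : ℝ) (w : EuclideanSpace ℝ (Fin n)) :
    ℕ → EuclideanSpace ℝ (Fin n) × EuclideanSpace ℝ (Fin n)
  | 0 => (w, w)
  | j + 1 =>
    let p := nesterovIter φ S L w j
    let y := projOn S (p.2 - (1 / L) • gradient φ p.2)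
    (y, y + ((nesterovParam j - 1) / nesterovParam (j + 1)) • (y - p.1))

namespace LinConstrProgram

variable {n m : ℕ} (P : LinConstrProgram n m)

/-- The residual `G u + g`. -/
noncomputable def resid (u : EuclideanSpace ℝ (Fin n)) : EuclideanSpace ℝ (Fin m) := P.G u + P.g

/-- The feasible points of the program. -/
def feasible : Set (EuclideanSpace ℝ (Fin n)) := {u | u ∈ P.U ∧ P.resid u = 0}

/-- The optimal solution set `U*`. -/
def solutions : Set (EuclideanSpace ℝ (Fin n)) := {u | u ∈ P.feasible ∧ ∀ v ∈ P.feasible, P.f u ≤ P.f v}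

/-- The optimal value `f*`. -/
noncomputable def optVal : ℝ := sInf (P.f '' P.feasible)

/-- `L_{μρ}(u,x) = f(u) + ⟨x, Gu+g⟩ + ρ/2 ‖Gu+g‖² - μ/2 ‖x‖²`. -/
noncomputable def lagr (μ ρ : ℝ) (u : EuclideanSpace ℝ (Fin n)) (x : EuclideanSpace ℝ (Fin m)) : ℝ :=
  P.f u + inner ℝ x (P.resid u) + ρ / 2 * ‖P.resid u‖ ^ 2 - μ / 2 * ‖x‖ ^ 2

/-- The (augmented) dual function `d_ρ(x) = min_{u ∈ U} L_{0ρ}(u,x)`; `ρ = 0` gives the dual `d`. -/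
noncomputable def dual (ρ : ℝ) (x : EuclideanSpace ℝ (Fin m)) : ℝ :=
  sInf ((fun u => P.lagr 0 ρ u x) '' P.U)

/-- The smoothed primal function `f_μ(u) = max_x L_{μ0}(u,x)`. -/
noncomputable def smoothedPrimal (μ : ℝ) (u : EuclideanSpace ℝ (Fin n)) : ℝ := ⨆ x, P.lagr μ 0 u x

/-- The smoothed duality gap `f_μ(u) - d_ρ(x)`. -/
noncomputable def smoothedGap (μ ρ : ℝ) (u : EuclideanSpace ℝ (Fin n))
    (x : EuclideanSpace ℝ (Fin m)) : ℝ :=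
  P.smoothedPrimal μ u - P.dual ρ x

/-- `x` is an optimal Lagrange multiplier: the dual function attains the value `f*` at `x`. -/
def IsMultiplier (x : EuclideanSpace ℝ (Fin m)) : Prop := P.dual 0 x = P.optVal

/-- `u` is an `ε`-optimal solution. -/
def IsEpsOptimal (ε : ℝ) (u : EuclideanSpace ℝ (Fin n)) : Prop :=
  u ∈ P.U ∧ P.f u - P.optVal ≤ ε ∧ ‖P.resid u‖ ≤ ε

/-- The iterates of Nesterov's method, started at `w`, on `min_{u ∈ U} L_{0ρ}(u,x)`. -/
noncomputable def innerIter (Lf ρ : ℝ) (x : EuclideanSpace ℝ (Fin m))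
    (w : EuclideanSpace ℝ (Fin n)) (j : ℕ) : EuclideanSpace ℝ (Fin n) :=
  (nesterovIter (fun u => P.lagr 0 ρ u x) P.U (Lf + ρ * ‖P.G‖ ^ 2) w j).1

/-- The number of projections of an inner call with accuracy `δ`: the index of the first iterate
with `L_{0ρ}(u,x) - d_ρ(x) ≤ δ`. -/
noncomputable def innerCount (Lf ρ δ : ℝ) (x : EuclideanSpace ℝ (Fin m))
    (w : EuclideanSpace ℝ (Fin n)) : ℕ :=
  sInf {j : ℕ | P.lagr 0 ρ (P.innerIter Lf ρ x w j) x - P.dual ρ x ≤ δ}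

/-- The output of an inner call. -/
noncomputable def innerSol (Lf ρ δ : ℝ) (x : EuclideanSpace ℝ (Fin m))
    (w : EuclideanSpace ℝ (Fin n)) : EuclideanSpace ℝ (Fin n) :=
  P.innerIter Lf ρ x w (P.innerCount Lf ρ δ x w)

end LinConstrProgram

/-- The outer state `(u^k, x^k, μ_k)`. -/
structure IFALState (n m : ℕ) where
  u : EuclideanSpace ℝ (Fin n)
  x : EuclideanSpace ℝ (Fin m)
  μ : ℝ

namespace LinConstrProgram

variable {n m : ℕ} (P : LinConstrProgram n m)

/-- `x̂ = (1 - τ) x + (τ / μ) (G u + g)`. -/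
noncomputable def xhat (τ : ℝ) (s : IFALState n m) : EuclideanSpace ℝ (Fin m) :=
  (1 - τ) • s.x + (τ / s.μ) • P.resid s.u

/-- One outer iteration, with the inner call started at `w`. -/
noncomputable def ifalStep (Lf ρ τ δ : ℝ) (w : EuclideanSpace ℝ (Fin n)) (s : IFALState n m) :
    IFALState n m :=
  let xh := P.xhat τ s
  let ut := P.innerSol Lf ρ δ xh w
  { u := (1 - τ) • s.u + τ • ut
    x := xh + ρ • P.resid ut
    μ := (1 - τ) * s.μ }

/-- The sequence generated by the IFAL method from the state `s₀`, with step sizes `τ_k`, inner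
accuracies `δ_k` and inner starting points `w_k`. -/
noncomputable def ifal (Lf ρ : ℝ) (τ δ : ℕ → ℝ) (w : ℕ → EuclideanSpace ℝ (Fin n))
    (s₀ : IFALState n m) : ℕ → IFALState n m
  | 0 => s₀
  | k + 1 => P.ifalStep Lf ρ (τ k) (δ k) (w k) (ifal Lf ρ τ δ w s₀ k)

/-- The number of projections onto `U` performed in outer iteration `k`. -/
noncomputable def ifalCount (Lf ρ : ℝ) (τ δ : ℕ → ℝ) (w : ℕ → EuclideanSpace ℝ (Fin n))
    (s₀ : IFALState n m) (k : ℕ) : ℕ :=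
  P.innerCount Lf ρ (δ k) (P.xhat (τ k) (P.ifal Lf ρ τ δ w s₀ k)) (w k)

/-- The inner error `L_{0ρ}(ũ_ρ(x̂^k), x̂^k) - d_ρ(x̂^k)` in outer iteration `k`. -/
noncomputable def ifalInnerError (Lf ρ : ℝ) (τ δ : ℕ → ℝ) (w : ℕ → EuclideanSpace ℝ (Fin n))
    (s₀ : IFALState n m) (k : ℕ) : ℝ :=
  let xh := P.xhat (τ k) (P.ifal Lf ρ τ δ w s₀ k)
  P.lagr 0 ρ (P.innerSol Lf ρ (δ k) xh (w k)) xh - P.dual ρ xh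

end LinConstrProgram

/-- The step sizes `τ_k = 2 / (k + 3)`. -/
noncomputable def ifalTau (k : ℕ) : ℝ := 2 / ((k : ℝ) + 3)

/-- The inner accuracies `δ_k = ε / (2 (k + 3))`. -/
noncomputable def ifalDelta (ε : ℝ) (k : ℕ) : ℝ := ε / (2 * ((k : ℝ) + 3))

/-- The constant `γ`, with `b` the norm of the multiplier. -/
noncomputable def ifalGamma (ε ρ b : ℝ) : ℝ :=
  max (√(ε / 3)) (max (√(32 / ρ)) (√(8 * b / ρ + 2 * √(4 * ε / (3 * ρ)))))

/-! The proof follows the gap `f_μ(u) - d_ρ(x)`, in which the maximum over `x` is explicit: `f_μ(u)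
= f(u) + ‖Gu+g‖² / (2μ)`. An outer step turns a gap `Δ` into at most `(1 - τ)Δ + 3δ`
(`gap_step_le`): `x̂` is chosen so that the cross terms of `u` and `ũ` cancel, and the increase of
`d_ρ` absorbs the remaining square of the residual as long as `τ² / (2(1 - τ)μ) ≤ ρ/4`. Since `3δ_k
≤ τ_k ε`, the bound `ε` on the gap is preserved (`gap_ifal_le`).

A gap at most `ε` gives `f(u) - f* ≤ ε` by weak duality. The multiplier then gives `R² / (2μ) ≤ ε +
‖x*‖ R` for the residual norm `R`, which forces `R ≤ ε` once `μ` is small against `ε`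
(`isEpsOptimal_of_gap_le`). As `μ_k = 8 / (ρ(k+1)(k+2))`, some `K` of order `γ/√ε` suffices. The
`O(1/j²)` rate of the inner method bounds the cost of call `k` by a multiple of `√(k/ε)`, and
summation gives `K^(3/2) ε^(-1/2)`, hence `ε^(-5/4)`. -/

/-! ### Gradient inequality and descent lemma -/

section Analysis

variable {E : Type*} [NormedAddCommGroup E] [InnerProductSpace ℝ E] [CompleteSpace E]

theorem hasDerivAt_comp_add_smul_of_differentiable {f : E → ℝ} (hf : Differentiable ℝ f)
    (u d : E) (t : ℝ) :
    HasDerivAt (fun t : ℝ => f (u + t • d)) (inner ℝ (gradient f (u + t • d)) d) t := by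
  have h1 : HasDerivAt (fun t : ℝ => u + t • d) d t := by
    simpa using ((hasDerivAt_id t).smul_const d).const_add u
  have h2 := (hf (u + t • d)).hasFDerivAt.comp_hasDerivAt t h1
  rw [inner_gradient_left]
  exact h2

/-- The gradient inequality for a convex function. -/
theorem ConvexOn.add_inner_gradient_le {f : E → ℝ} (hc : ConvexOn ℝ Set.univ f)
    (hf : Differentiable ℝ f) (u v : E) :
    f u + inner ℝ (gradient f u) (v - u) ≤ f v := by
  have hd := hasDerivAt_comp_add_smul_of_differentiable hf u (v - u) 0
  have hconv : ConvexOn ℝ Set.univ (fun t : ℝ => f (u + t • (v - u))) := by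
    refine ⟨convex_univ, fun x _ y _ a b ha hb hab => ?_⟩
    have h := hc.2 (Set.mem_univ (u + x • (v - u))) (Set.mem_univ (u + y • (v - u))) ha hb hab
    have e : u + (a • x + b • y) • (v - u)
        = a • (u + x • (v - u)) + b • (u + y • (v - u)) := by
      have : a • u + b • u = u := by rw [← add_smul, hab, one_smul]
      simp only [smul_eq_mul, smul_add, add_smul, mul_smul]
      nth_rewrite 1 [← this]
      abel
    simpa only [e] using h
  have h := hconv.le_slope_of_hasDerivAt (Set.mem_univ (0 : ℝ)) (Set.mem_univ (1 : ℝ))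
    zero_lt_one hd
  simp only [slope_def_field, zero_smul, one_smul, add_zero, sub_zero, div_one,
    add_sub_cancel] at h
  linarith

/-- The descent lemma for a function with Lipschitz gradient. -/
theorem le_add_inner_gradient_add_sq {f : E → ℝ} (hf : Differentiable ℝ f) {L : ℝ}
    (hL : ∀ u v, ‖gradient f u - gradient f v‖ ≤ L * ‖u - v‖) (u v : E) :
    f v ≤ f u + inner ℝ (gradient f u) (v - u) + L / 2 * ‖v - u‖ ^ 2 := by
  set d := v - u with hd
  have hB : ∀ t : ℝ, HasDerivAt
      (fun t : ℝ => f u + t * inner ℝ (gradient f u) d + L / 2 * ‖d‖ ^ 2 * t ^ 2)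
      (inner ℝ (gradient f u) d + L * ‖d‖ ^ 2 * t) t := by
    intro t
    have h := (((hasDerivAt_id t).mul_const (inner ℝ (gradient f u) d)).const_add (f u)).add
      ((hasDerivAt_pow 2 t).const_mul (L / 2 * ‖d‖ ^ 2))
    refine HasDerivAt.congr_deriv h ?_
    norm_num
    ring
  have hA := hasDerivAt_comp_add_smul_of_differentiable hf u d
  have key := image_le_of_deriv_right_le_deriv_boundary (a := (0 : ℝ)) (b := 1)
    (f := fun t : ℝ => f (u + t • d))
    (f' := fun t => inner ℝ (gradient f (u + t • d)) d)
    (fun t _ => (hA t).continuousAt.continuousWithinAt)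
    (fun t _ => (hA t).hasDerivWithinAt)
    (B := fun t : ℝ => f u + t * inner ℝ (gradient f u) d + L / 2 * ‖d‖ ^ 2 * t ^ 2)
    (B' := fun t => inner ℝ (gradient f u) d + L * ‖d‖ ^ 2 * t)
    (by simp)
    (fun t _ => (hB t).continuousAt.continuousWithinAt)
    (fun t _ => (hB t).hasDerivWithinAt)
    (by
      intro t ht
      have h1 : inner ℝ (gradient f (u + t • d) - gradient f u) d
          ≤ ‖gradient f (u + t • d) - gradient f u‖ * ‖d‖ := real_inner_le_norm _ _
      have h2 := hL (u + t • d) u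
      rw [add_sub_cancel_left, norm_smul, Real.norm_of_nonneg ht.1] at h2
      rw [inner_sub_left] at h1
      have h3 := mul_le_mul_of_nonneg_right h2 (norm_nonneg d)
      nlinarith)
    (x := 1) (by simp)
  have e : u + d = v := by rw [hd]; abel
  simp only [one_smul, one_mul, one_pow, mul_one, e] at key
  exact key

end Analysis

/-! ### Convergence rate of the accelerated projected gradient method -/

section Nesterov

theorem nesterovParam_sq (j : ℕ) :
    nesterovParam (j + 1) ^ 2 - nesterovParam (j + 1) = nesterovParam j ^ 2 := by
  have h : √(1 + 4 * nesterovParam j ^ 2) ^ 2 = 1 + 4 * nesterovParam j ^ 2 :=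
    Real.sq_sqrt (by positivity)
  rw [nesterovParam]
  linear_combination h / 4

theorem le_nesterovParam (j : ℕ) : ((j : ℝ) + 2) / 2 ≤ nesterovParam j := by
  induction j with
  | zero => simp [nesterovParam]
  | succ j ih =>
    have h : 2 * nesterovParam j ≤ √(1 + 4 * nesterovParam j ^ 2) :=
      Real.le_sqrt_of_sq_le (by nlinarith)
    rw [nesterovParam]
    push_cast
    linarith

theorem one_le_nesterovParam (j : ℕ) : 1 ≤ nesterovParam j := by
  have := le_nesterovParam j
  have : (0 : ℝ) ≤ j := j.cast_nonneg
  linarith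

variable {n : ℕ} {S : Set (EuclideanSpace ℝ (Fin n))}

theorem inner_sub_projOn_le_zero (hcl : IsClosed S) (hconv : Convex ℝ S)
    (x : EuclideanSpace ℝ (Fin n)) {v : EuclideanSpace ℝ (Fin n)} (hv : v ∈ S) :
    inner ℝ (x - projOn S x) (v - projOn S x) ≤ 0 := by
  obtain ⟨hp, hmin⟩ := projOn_spec ⟨v, hv⟩ hcl x
  refine (norm_eq_iInf_iff_real_inner_le_zero hconv hp).1 ?_ v hv
  have : Nonempty S := ⟨⟨v, hv⟩⟩
  exact le_antisymm (le_ciInf fun w => hmin w w.2)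
    (ciInf_le (f := fun w : S => ‖x - w‖) ⟨0, by rintro _ ⟨_, rfl⟩; exact norm_nonneg _⟩ ⟨_, hp⟩)

theorem nesterovIter_fst_mem (φ : EuclideanSpace ℝ (Fin n) → ℝ) (hcl : IsClosed S) (L : ℝ)
    {w : EuclideanSpace ℝ (Fin n)} (hw : w ∈ S) (j : ℕ) : (nesterovIter φ S L w j).1 ∈ S := by
  cases j with
  | zero => exact hw
  | succ j => exact (projOn_spec ⟨w, hw⟩ hcl _).1

/-- One projected gradient step from `z`. -/
theorem projOn_gradient_step {φ : EuclideanSpace ℝ (Fin n) → ℝ} {L : ℝ} (hL : 0 < L)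
    (hcl : IsClosed S) (hconv : Convex ℝ S)
    (hlow : ∀ u v, φ u + inner ℝ (gradient φ u) (v - u) ≤ φ v)
    (hup : ∀ u v, φ v ≤ φ u + inner ℝ (gradient φ u) (v - u) + L / 2 * ‖v - u‖ ^ 2)
    (z : EuclideanSpace ℝ (Fin n)) {u : EuclideanSpace ℝ (Fin n)} (hu : u ∈ S) :
    φ (projOn S (z - (1 / L) • gradient φ z))
        + L / 2 * ‖projOn S (z - (1 / L) • gradient φ z) - u‖ ^ 2
      ≤ φ u + L / 2 * ‖z - u‖ ^ 2 := by
  have hp := inner_sub_projOn_le_zero hcl hconv (z - (1 / L) • gradient φ z) hu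
  set y := projOn S (z - (1 / L) • gradient φ z)
  have h1 := hup z y
  have h2 := hlow z u
  have e1 : z - (1 / L) • gradient φ z - y = (z - y) - (1 / L) • gradient φ z := by abel
  rw [e1, inner_sub_left, real_inner_smul_left] at hp
  have h3 : L * inner ℝ (z - y) (u - y) ≤ inner ℝ (gradient φ z) (u - y) := by
    have := mul_le_mul_of_nonneg_left hp hL.le
    field_simp at this
    linarith
  have e2 : ‖z - u‖ ^ 2 = ‖z - y‖ ^ 2 - 2 * inner ℝ (z - y) (u - y) + ‖y - u‖ ^ 2 := by
    have : z - u = (z - y) - (u - y) := by abel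
    rw [this, norm_sub_sq_real, norm_sub_rev u y]
  have e3 : inner ℝ (gradient φ z) (u - z)
      = inner ℝ (gradient φ z) (u - y) + inner ℝ (gradient φ z) (y - z) := by
    rw [← inner_add_right]; congr 1; abel
  rw [norm_sub_rev y z] at h1
  rw [e2]
  nlinarith

/-- The potential of Nesterov's method does not increase along the iteration. -/
theorem nesterovIter_potential {φ : EuclideanSpace ℝ (Fin n) → ℝ} {L : ℝ} (hL : 0 < L)
    (hcl : IsClosed S) (hconv : Convex ℝ S) (hφ : ConvexOn ℝ Set.univ φ)
    (hlow : ∀ u v, φ u + inner ℝ (gradient φ u) (v - u) ≤ φ v)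
    (hup : ∀ u v, φ v ≤ φ u + inner ℝ (gradient φ u) (v - u) + L / 2 * ‖v - u‖ ^ 2)
    {w u : EuclideanSpace ℝ (Fin n)} (hw : w ∈ S) (hu : u ∈ S) (j : ℕ) :
    nesterovParam j ^ 2 * (φ (nesterovIter φ S L w (j + 1)).1 - φ u)
        + L / 2 * ‖nesterovParam j • (nesterovIter φ S L w (j + 1)).1
            - (nesterovParam j - 1) • (nesterovIter φ S L w j).1 - u‖ ^ 2
      ≤ L / 2 * ‖w - u‖ ^ 2 := by
  have step : ∀ j, nesterovParam j ^ 2 * (φ (nesterovIter φ S L w (j + 1)).1 - φ u)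
        + L / 2 * ‖nesterovParam j • (nesterovIter φ S L w (j + 1)).1
            - (nesterovParam j - 1) • (nesterovIter φ S L w j).1 - u‖ ^ 2
      ≤ (nesterovParam j ^ 2 - nesterovParam j) * (φ (nesterovIter φ S L w j).1 - φ u)
        + L / 2 * ‖nesterovParam j • (nesterovIter φ S L w j).2
            - (nesterovParam j - 1) • (nesterovIter φ S L w j).1 - u‖ ^ 2 := by
    intro j
    set t := nesterovParam j with ht
    have ht1 : 1 ≤ t := one_le_nesterovParam j
    have ht0 : 0 < t := by linarith
    set y := (nesterovIter φ S L w j).1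
    set z := (nesterovIter φ S L w j).2
    have hy : y ∈ S := nesterovIter_fst_mem φ hcl L hw j
    have e0 : (nesterovIter φ S L w (j + 1)).1 = projOn S (z - (1 / L) • gradient φ z) := rfl
    rw [e0]
    have hnn : 0 ≤ 1 - 1 / t := by
      rw [sub_nonneg, div_le_one ht0]; exact ht1
    -- Comparing with this point of the segment from `y` to `u`, then scaling by `t²`, produces the
    -- weights of the potential.
    have hv : (1 - 1 / t) • y + (1 / t) • u ∈ S := hconv hy hu hnn (by positivity) (by ring)
    have h1 := projOn_gradient_step hL hcl hconv hlow hup z hv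
    have h2 := hφ.2 (Set.mem_univ y) (Set.mem_univ u) hnn
      (by positivity : (0 : ℝ) ≤ 1 / t) (by ring)
    simp only [smul_eq_mul] at h2
    have hs : ∀ p : EuclideanSpace ℝ (Fin n),
        ‖t • p - (t - 1) • y - u‖ ^ 2 = t ^ 2 * ‖p - ((1 - 1 / t) • y + (1 / t) • u)‖ ^ 2 := by
      intro p
      have : t • p - (t - 1) • y - u = t • (p - ((1 - 1 / t) • y + (1 / t) • u)) := by
        rw [smul_sub, smul_add, smul_smul, smul_smul, mul_sub, mul_one_div_cancel ht0.ne', mul_one,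
          one_smul]
        abel
      rw [this, norm_smul, mul_pow, Real.norm_of_nonneg ht0.le]
    rw [hs, hs]
    have h3 := mul_le_mul_of_nonneg_left (h1.trans (add_le_add_left h2 _)) (sq_nonneg t)
    have e1 : t ^ 2 * ((1 - 1 / t) * φ y + 1 / t * φ u) = (t ^ 2 - t) * φ y + t * φ u := by
      field_simp
    rw [mul_add, mul_add, e1] at h3
    linarith
  induction j with
  | zero =>
    have := step 0
    simpa [nesterovParam, nesterovIter] using this
  | succ j ih =>
    refine (step (j + 1)).trans (le_of_eq_of_le ?_ ih)
    have ht0 : nesterovParam (j + 1) ≠ 0 := by have := one_le_nesterovParam (j + 1); linarith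
    have e : (nesterovIter φ S L w (j + 1)).2 = (nesterovIter φ S L w (j + 1)).1
        + ((nesterovParam j - 1) / nesterovParam (j + 1)) •
          ((nesterovIter φ S L w (j + 1)).1 - (nesterovIter φ S L w j).1) := rfl
    -- The parameter recursion matches the function values. The momentum coefficient is the one for
    -- which `t' z' - (t' - 1) y' = t y' - (t - 1) y`, primes marking index `j + 1`, so the squared
    -- norms match too.
    rw [nesterovParam_sq, e]
    congr 4
    rw [smul_add, smul_smul, mul_div_cancel₀ _ ht0]
    module

/-- The `O(1 / j²)` rate of Nesterov's method. -/
theorem nesterovIter_sub_le {φ : EuclideanSpace ℝ (Fin n) → ℝ} {L : ℝ} (hL : 0 < L)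
    (hcl : IsClosed S) (hconv : Convex ℝ S) (hbdd : Bornology.IsBounded S)
    (hφ : ConvexOn ℝ Set.univ φ)
    (hlow : ∀ u v, φ u + inner ℝ (gradient φ u) (v - u) ≤ φ v)
    (hup : ∀ u v, φ v ≤ φ u + inner ℝ (gradient φ u) (v - u) + L / 2 * ‖v - u‖ ^ 2)
    {w u : EuclideanSpace ℝ (Fin n)} (hw : w ∈ S) (hu : u ∈ S) (j : ℕ) :
    φ (nesterovIter φ S L w (j + 1)).1 - φ u ≤ 2 * L * Metric.diam S ^ 2 / ((j : ℝ) + 2) ^ 2 := by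
  have h := nesterovIter_potential hL hcl hconv hφ hlow hup hw hu j
  have hd : ‖w - u‖ ≤ Metric.diam S := by
    rw [← dist_eq_norm]; exact Metric.dist_le_diam_of_mem hbdd hw hu
  have hd2 : ‖w - u‖ ^ 2 ≤ Metric.diam S ^ 2 := by gcongr
  have hj : (0 : ℝ) < (j : ℝ) + 2 := by positivity
  have ht := le_nesterovParam j
  have ht2 : (((j : ℝ) + 2) / 2) ^ 2 ≤ nesterovParam j ^ 2 := by gcongr
  set a := φ (nesterovIter φ S L w (j + 1)).1 - φ u
  have hL2 : L / 2 * ‖w - u‖ ^ 2 ≤ L / 2 * Metric.diam S ^ 2 := by gcongr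
  have h4 : nesterovParam j ^ 2 * a ≤ L / 2 * Metric.diam S ^ 2 := by
    have : 0 ≤ L / 2 * ‖nesterovParam j • (nesterovIter φ S L w (j + 1)).1
            - (nesterovParam j - 1) • (nesterovIter φ S L w j).1 - u‖ ^ 2 := by positivity
    linarith
  rw [le_div_iff₀ (by positivity)]
  -- `u` need not be a minimizer, so `a` may be negative; the lower bound on `t_j²` helps only when
  -- `a > 0`.
  rcases le_or_gt a 0 with ha | ha
  · have : 0 ≤ 2 * L * Metric.diam S ^ 2 := by positivity
    have : a * ((j : ℝ) + 2) ^ 2 ≤ 0 := mul_nonpos_of_nonpos_of_nonneg ha (by positivity)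
    linarith
  · have := mul_le_mul_of_nonneg_right ht2 ha.le
    nlinarith

end Nesterov

/-! ### Convexity and smoothness of the augmented Lagrangian -/

namespace LinConstrProgram

variable {n m : ℕ} (P : LinConstrProgram n m)

theorem resid_combo {a b : ℝ} (hab : a + b = 1) (u v : EuclideanSpace ℝ (Fin n)) :
    P.resid (a • u + b • v) = a • P.resid u + b • P.resid v := by
  have h : P.g = a • P.g + b • P.g := by rw [← add_smul, hab, one_smul]
  simp only [resid, map_add, map_smul, smul_add]
  nth_rewrite 1 [h]
  abel

theorem resid_add_smul (u d : EuclideanSpace ℝ (Fin n)) (t : ℝ) :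
    P.resid (u + t • d) = P.resid u + t • P.G d := by
  simp only [resid, map_add, map_smul]
  abel

/-- On a line the Lagrangian differs from `f` by an explicit quadratic in `t`; its gradient,
convexity bound and Lipschitz constant are all read off from this. -/
theorem lagr_zero_add_smul (ρ : ℝ) (u d : EuclideanSpace ℝ (Fin n))
    (x : EuclideanSpace ℝ (Fin m)) (t : ℝ) :
    P.lagr 0 ρ (u + t • d) x = P.f (u + t • d) + (P.lagr 0 ρ u x - P.f u)
      + t * inner ℝ (x + ρ • P.resid u) (P.G d) + ρ / 2 * ‖P.G d‖ ^ 2 * t ^ 2 := by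
  simp only [lagr, resid_add_smul, inner_add_right, inner_add_left, real_inner_smul_left,
    real_inner_smul_right, norm_add_sq_real, norm_smul, mul_pow, Real.norm_eq_abs, sq_abs]
  ring

theorem differentiable_lagr (hf : Differentiable ℝ P.f) (μ ρ : ℝ)
    (x : EuclideanSpace ℝ (Fin m)) : Differentiable ℝ fun u => P.lagr μ ρ u x := by
  have hr : Differentiable ℝ P.resid := P.G.differentiable.add_const P.g
  exact ((hf.add ((differentiable_const x).inner ℝ hr)).add ((hr.norm_sq ℝ).const_mul _)).sub_const _

theorem inner_gradient_lagr (hf : Differentiable ℝ P.f) (ρ : ℝ) (u d : EuclideanSpace ℝ (Fin n))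
    (x : EuclideanSpace ℝ (Fin m)) :
    inner ℝ (gradient (fun u => P.lagr 0 ρ u x) u) d
      = inner ℝ (gradient P.f u) d + inner ℝ (x + ρ • P.resid u) (P.G d) := by
  have h1 := hasDerivAt_comp_add_smul_of_differentiable (P.differentiable_lagr hf 0 ρ x) u d 0
  have h2 := (((hasDerivAt_comp_add_smul_of_differentiable hf u d 0).add_const
    (P.lagr 0 ρ u x - P.f u)).add ((hasDerivAt_id (0 : ℝ)).mul_const
      (inner ℝ (x + ρ • P.resid u) (P.G d)))).add
        ((hasDerivAt_pow 2 (0 : ℝ)).const_mul (ρ / 2 * ‖P.G d‖ ^ 2))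
  simp only [zero_smul, add_zero] at h1 h2
  have h3 := h1.unique (h2.congr_of_eventuallyEq
    (Filter.Eventually.of_forall fun t => P.lagr_zero_add_smul ρ u d x t))
  rw [h3]
  simp

theorem lagr_gradient_le (hc : ConvexOn ℝ Set.univ P.f) (hf : Differentiable ℝ P.f) {ρ : ℝ}
    (hρ : 0 ≤ ρ) (x : EuclideanSpace ℝ (Fin m)) (u v : EuclideanSpace ℝ (Fin n)) :
    P.lagr 0 ρ u x + inner ℝ (gradient (fun u => P.lagr 0 ρ u x) u) (v - u) ≤ P.lagr 0 ρ v x := by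
  have h1 := hc.add_inner_gradient_le hf u v
  have h2 := P.lagr_zero_add_smul ρ u (v - u) x 1
  rw [one_smul, add_sub_cancel] at h2
  rw [P.inner_gradient_lagr hf, h2]
  have : 0 ≤ ρ / 2 * ‖P.G (v - u)‖ ^ 2 := by positivity
  linarith

theorem lagr_le_gradient (hf : Differentiable ℝ P.f) {Lf ρ : ℝ}
    (hL : ∀ u v, ‖gradient P.f u - gradient P.f v‖ ≤ Lf * ‖u - v‖)
    (hρ : 0 ≤ ρ) (x : EuclideanSpace ℝ (Fin m)) (u v : EuclideanSpace ℝ (Fin n)) :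
    P.lagr 0 ρ v x ≤ P.lagr 0 ρ u x + inner ℝ (gradient (fun u => P.lagr 0 ρ u x) u) (v - u)
      + (Lf + ρ * ‖P.G‖ ^ 2) / 2 * ‖v - u‖ ^ 2 := by
  have h1 := le_add_inner_gradient_add_sq hf hL u v
  have h2 := P.lagr_zero_add_smul ρ u (v - u) x 1
  rw [one_smul, add_sub_cancel] at h2
  rw [P.inner_gradient_lagr hf, h2]
  have h3 : ‖P.G (v - u)‖ ^ 2 ≤ (‖P.G‖ * ‖v - u‖) ^ 2 := by
    gcongr
    exact P.G.le_opNorm _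
  have h4 := mul_le_mul_of_nonneg_left h3 (by positivity : 0 ≤ ρ / 2)
  nlinarith

/-- The last term is the exact convexity defect of `ρ/2 ‖·‖²` on residuals. It is kept because the
quadratic growth estimate rests on it. -/
theorem lagr_combo_le (hc : ConvexOn ℝ Set.univ P.f) (ρ : ℝ) (x : EuclideanSpace ℝ (Fin m))
    (u v : EuclideanSpace ℝ (Fin n)) {a b : ℝ} (ha : 0 ≤ a) (hb : 0 ≤ b) (hab : a + b = 1) :
    P.lagr 0 ρ (a • u + b • v) x ≤ a * P.lagr 0 ρ u x + b * P.lagr 0 ρ v x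
      - a * b * (ρ / 2) * ‖P.resid v - P.resid u‖ ^ 2 := by
  have h := hc.2 (Set.mem_univ u) (Set.mem_univ v) ha hb hab
  simp only [smul_eq_mul] at h
  obtain rfl : a = 1 - b := by linarith
  simp only [lagr, P.resid_combo hab, inner_add_right, real_inner_smul_left,
    real_inner_smul_right, norm_add_sq_real, norm_sub_sq_real, norm_smul, mul_pow,
    Real.norm_eq_abs, sq_abs, real_inner_comm (P.resid v) (P.resid u)]
  linarith

theorem convexOn_lagr (hc : ConvexOn ℝ Set.univ P.f) {ρ : ℝ} (hρ : 0 ≤ ρ)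
    (x : EuclideanSpace ℝ (Fin m)) : ConvexOn ℝ Set.univ fun u => P.lagr 0 ρ u x := by
  refine ⟨convex_univ, fun u _ v _ a b ha hb hab => ?_⟩
  have h := P.lagr_combo_le hc ρ x u v ha hb hab
  have : 0 ≤ a * b * (ρ / 2) * ‖P.resid v - P.resid u‖ ^ 2 := by positivity
  simp only [smul_eq_mul]
  linarith

theorem dual_le_lagr (hcl : IsClosed P.U) (hbdd : Bornology.IsBounded P.U)
    (hf : Differentiable ℝ P.f) (ρ : ℝ) (x : EuclideanSpace ℝ (Fin m))
    {u : EuclideanSpace ℝ (Fin n)} (hu : u ∈ P.U) : P.dual ρ x ≤ P.lagr 0 ρ u x :=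
  csInf_le ((Metric.isCompact_of_isClosed_isBounded hcl hbdd).bddBelow_image
    (P.differentiable_lagr hf 0 ρ x).continuous.continuousOn) ⟨u, hu, rfl⟩

theorem le_dual (ρ : ℝ) (x : EuclideanSpace ℝ (Fin m)) {c : ℝ} (hne : P.U.Nonempty)
    (h : ∀ u ∈ P.U, c ≤ P.lagr 0 ρ u x) : c ≤ P.dual ρ x :=
  le_csInf (hne.image _) (by rintro _ ⟨u, hu, rfl⟩; exact h u hu)

/-! ### Cost of an inner call -/

section Inner

variable {Lf ρ δ : ℝ} {x : EuclideanSpace ℝ (Fin m)} {w : EuclideanSpace ℝ (Fin n)}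

theorem innerSol_mem (hcl : IsClosed P.U) (hw : w ∈ P.U) : P.innerSol Lf ρ δ x w ∈ P.U :=
  nesterovIter_fst_mem _ hcl _ hw _

theorem exists_innerIter_error_le (hcl : IsClosed P.U) (hconv : Convex ℝ P.U)
    (hbdd : Bornology.IsBounded P.U) (hc : ConvexOn ℝ Set.univ P.f) (hf : Differentiable ℝ P.f)
    (hLf : 0 < Lf) (hL : ∀ u v, ‖gradient P.f u - gradient P.f v‖ ≤ Lf * ‖u - v‖)
    (hρ : 0 < ρ) (hδ : 0 < δ) (hw : w ∈ P.U)
    (h1 : 1 ≤ 2 * Metric.diam P.U * √((Lf + ρ * ‖P.G‖ ^ 2) / δ)) :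
    P.lagr 0 ρ (P.innerIter Lf ρ x w
      ⌊2 * Metric.diam P.U * √((Lf + ρ * ‖P.G‖ ^ 2) / δ)⌋₊) x - P.dual ρ x ≤ δ := by
  set L := Lf + ρ * ‖P.G‖ ^ 2 with hLdef
  set D := Metric.diam P.U
  have hLpos : 0 < L := by positivity
  -- The rate covers only iterates of index `j + 1`, so the floor must be positive. Its denominator
  -- `(j + 2)²` uses floor plus one, which exceeds the real bound.
  obtain ⟨j, hj⟩ : ∃ j, ⌊2 * D * √(L / δ)⌋₊ = j + 1 :=
    Nat.exists_eq_succ_of_ne_zero (Nat.floor_pos.2 h1).ne'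
  have hlt := Nat.lt_floor_add_one (2 * D * √(L / δ))
  rw [hj] at hlt ⊢
  push_cast at hlt
  have hsq : (2 * D * √(L / δ)) ^ 2 ≤ ((j : ℝ) + 2) ^ 2 :=
    pow_le_pow_left₀ (by linarith) (by linarith) 2
  rw [mul_pow, Real.sq_sqrt (by positivity), mul_div_assoc', div_le_iff₀ hδ] at hsq
  have hle : 2 * L * D ^ 2 / ((j : ℝ) + 2) ^ 2 ≤ δ := by
    rw [div_le_iff₀ (by positivity)]
    have : 0 ≤ L * D ^ 2 := by positivity
    linarith
  have : P.lagr 0 ρ (P.innerIter Lf ρ x w (j + 1)) x - δ ≤ P.dual ρ x := by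
    refine P.le_dual ρ x ⟨w, hw⟩ fun u hu => ?_
    have := nesterovIter_sub_le (φ := fun u => P.lagr 0 ρ u x) hLpos hcl hconv hbdd
      (P.convexOn_lagr hc hρ.le x) (P.lagr_gradient_le hc hf hρ.le x)
      (P.lagr_le_gradient hf hL hρ.le x) hw hu j
    unfold innerIter
    linarith
  linarith

/-- An inner call with accuracy `δ` terminates and costs at most `2 D √(L / δ)` projections. -/
theorem innerSol_error_le_and_innerCount_le (hcl : IsClosed P.U) (hconv : Convex ℝ P.U)
    (hbdd : Bornology.IsBounded P.U) (hc : ConvexOn ℝ Set.univ P.f) (hf : Differentiable ℝ P.f)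
    (hLf : 0 < Lf) (hL : ∀ u v, ‖gradient P.f u - gradient P.f v‖ ≤ Lf * ‖u - v‖)
    (hρ : 0 < ρ) (hδ : 0 < δ) (hw : w ∈ P.U)
    (h1 : 1 ≤ 2 * Metric.diam P.U * √((Lf + ρ * ‖P.G‖ ^ 2) / δ)) :
    P.lagr 0 ρ (P.innerSol Lf ρ δ x w) x - P.dual ρ x ≤ δ ∧
      (P.innerCount Lf ρ δ x w : ℝ) ≤ 2 * Metric.diam P.U * √((Lf + ρ * ‖P.G‖ ^ 2) / δ) := by
  have h := P.exists_innerIter_error_le (x := x) hcl hconv hbdd hc hf hLf hL hρ hδ hw h1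
  -- A nonempty set of accurate indices is essential: `sInf ∅ = 0` would count no projections
  -- without certifying accuracy.
  refine ⟨Nat.sInf_mem (s := {j : ℕ | P.lagr 0 ρ (P.innerIter Lf ρ x w j) x - P.dual ρ x ≤ δ})
    ⟨_, h⟩, ?_⟩
  exact (Nat.cast_le.2 (Nat.sInf_le h)).trans (Nat.floor_le (by linarith))

end Inner

/-! ### One outer step and the meaning of a small gap -/

section Outer

variable {ρ δ : ℝ} {x : EuclideanSpace ℝ (Fin m)} {ut : EuclideanSpace ℝ (Fin n)}

/-- Quadratic growth of the augmented Lagrangian, in the residual, around an inexact minimizer. -/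
theorem lagr_quadratic_growth (hcl : IsClosed P.U) (hconv : Convex ℝ P.U)
    (hbdd : Bornology.IsBounded P.U) (hc : ConvexOn ℝ Set.univ P.f) (hf : Differentiable ℝ P.f)
    (hut : ut ∈ P.U) (hδ : P.lagr 0 ρ ut x - P.dual ρ x ≤ δ)
    {u : EuclideanSpace ℝ (Fin n)} (hu : u ∈ P.U) :
    P.lagr 0 ρ ut x - 3 * δ + ρ / 3 * ‖P.resid u - P.resid ut‖ ^ 2 ≤ P.lagr 0 ρ u x := by
  -- A weight `b` on `u` yields error `δ/b` and growth `(1 - b)ρ/2`; `b = 1/3` gives `3δ` and `ρ/3`.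
  have h1 := P.lagr_combo_le hc ρ x ut u (a := 2 / 3) (b := 1 / 3) (by norm_num) (by norm_num)
    (by norm_num)
  have h2 := P.dual_le_lagr hcl hbdd hf ρ x
    (hconv hut hu (by norm_num : (0 : ℝ) ≤ 2 / 3) (by norm_num : (0 : ℝ) ≤ 1 / 3) (by norm_num))
  linarith

/-- Increase of the augmented dual function along an inexact gradient step. -/
theorem le_dual_add_smul_resid (hcl : IsClosed P.U) (hconv : Convex ℝ P.U)
    (hbdd : Bornology.IsBounded P.U) (hc : ConvexOn ℝ Set.univ P.f) (hf : Differentiable ℝ P.f)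
    (hρ : 0 < ρ) (hut : ut ∈ P.U) (hδ : P.lagr 0 ρ ut x - P.dual ρ x ≤ δ) :
    P.lagr 0 ρ ut x - 3 * δ + ρ / 4 * ‖P.resid ut‖ ^ 2 ≤ P.dual ρ (x + ρ • P.resid ut) := by
  refine P.le_dual ρ _ ⟨ut, hut⟩ fun u hu => ?_
  have h := P.lagr_quadratic_growth hcl hconv hbdd hc hf hut hδ hu
  have e : P.lagr 0 ρ u (x + ρ • P.resid ut)
      = P.lagr 0 ρ u x + ρ * inner ℝ (P.resid ut) (P.resid u) := by
    simp only [lagr, inner_add_left, real_inner_smul_left]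
    ring
  -- With `r = P.resid ut` and `d = P.resid u - r`, this square shows `ρ/3 ‖d‖² + ρ⟨r, d⟩ ≥
  -- -(3/4)ρ‖r‖²`, leaving `ρ/4 ‖r‖²`.
  have hsq : 0 ≤ ρ / 3 * ‖(P.resid u - P.resid ut) + (3 / 2 : ℝ) • P.resid ut‖ ^ 2 := by
    positivity
  rw [norm_add_sq_real, norm_smul, inner_smul_right, inner_sub_left, real_inner_self_eq_norm_sq,
    mul_pow, Real.norm_eq_abs, sq_abs, real_inner_comm] at hsq
  rw [e]
  nlinarith

/-- The value `f_μ(u) - d_ρ(x)`, with the maximum over `x` evaluated. -/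
noncomputable def gap (μ ρ : ℝ) (u : EuclideanSpace ℝ (Fin n)) (x : EuclideanSpace ℝ (Fin m)) : ℝ :=
  P.f u + ‖P.resid u‖ ^ 2 / (2 * μ) - P.dual ρ x

theorem gap_le_smoothedGap {μ : ℝ} (hμ : 0 < μ) (ρ : ℝ) (u : EuclideanSpace ℝ (Fin n))
    (x : EuclideanSpace ℝ (Fin m)) : P.gap μ ρ u x ≤ P.smoothedGap μ ρ u x := by
  refine sub_le_sub_right ?_ _
  -- Completing the square bounds the values, so the supremum is not the default `0`; the maximizer
  -- is `μ⁻¹ • P.resid u`.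
  have hb : BddAbove (Set.range fun x => P.lagr μ 0 u x) := by
    refine ⟨P.f u + ‖P.resid u‖ ^ 2 / (2 * μ), ?_⟩
    rintro _ ⟨x, rfl⟩
    have h : 0 ≤ ‖P.resid u - μ • x‖ ^ 2 / (2 * μ) := by positivity
    have e : ‖P.resid u - μ • x‖ ^ 2 / (2 * μ) = ‖P.resid u‖ ^ 2 / (2 * μ)
        - inner ℝ x (P.resid u) + μ / 2 * ‖x‖ ^ 2 := by
      rw [norm_sub_sq_real, norm_smul, real_inner_smul_right, mul_pow, Real.norm_eq_abs, sq_abs,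
        real_inner_comm]
      field_simp
    simp only [lagr]
    linarith
  refine le_of_eq_of_le ?_ (le_ciSup hb (μ⁻¹ • P.resid u))
  simp only [lagr, real_inner_smul_left, norm_smul, mul_pow, Real.norm_eq_abs, sq_abs,
    real_inner_self_eq_norm_sq]
  field_simp
  ring

/-- One outer step contracts the smoothed gap up to a multiple of the inner error. -/
theorem gap_step_le (hcl : IsClosed P.U) (hconv : Convex ℝ P.U)
    (hbdd : Bornology.IsBounded P.U) (hc : ConvexOn ℝ Set.univ P.f) (hf : Differentiable ℝ P.f)
    (hρ : 0 < ρ) {μ τ : ℝ} (hμ : 0 < μ) (hτ0 : 0 ≤ τ) (hτ1 : τ < 1)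
    (hstep : τ ^ 2 / (2 * ((1 - τ) * μ)) ≤ ρ / 4) (hut : ut ∈ P.U)
    (u : EuclideanSpace ℝ (Fin n))
    (hδ : P.lagr 0 ρ ut ((1 - τ) • x + (τ / μ) • P.resid u)
      - P.dual ρ ((1 - τ) • x + (τ / μ) • P.resid u) ≤ δ) :
    P.gap ((1 - τ) * μ) ρ ((1 - τ) • u + τ • ut)
        ((1 - τ) • x + (τ / μ) • P.resid u + ρ • P.resid ut)
      ≤ (1 - τ) * P.gap μ ρ u x + 3 * δ := by
  have hτ : 0 < 1 - τ := by linarith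
  have h1 := P.le_dual_add_smul_resid hcl hconv hbdd hc hf hρ hut hδ
  have h2 := P.dual_le_lagr hcl hbdd hf ρ x hut
  have h3 := hc.2 (Set.mem_univ u) (Set.mem_univ ut) hτ.le hτ0 (by ring)
  have h4 := mul_le_mul_of_nonneg_left h2 hτ.le
  have h5 := mul_le_mul_of_nonneg_right hstep (sq_nonneg ‖P.resid ut‖)
  have h6 : 0 ≤ τ * (ρ / 2) * ‖P.resid ut‖ ^ 2 := by positivity
  simp only [smul_eq_mul] at h3
  -- The cross term equals the one that the component `(τ / μ) • P.resid u` of `x̂` contributes to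
  -- the dual bound, so the two cancel.
  have e : ‖P.resid ((1 - τ) • u + τ • ut)‖ ^ 2 / (2 * ((1 - τ) * μ))
      = (1 - τ) * (‖P.resid u‖ ^ 2 / (2 * μ)) + τ / μ * inner ℝ (P.resid u) (P.resid ut)
        + τ ^ 2 / (2 * ((1 - τ) * μ)) * ‖P.resid ut‖ ^ 2 := by
    rw [P.resid_combo (by ring), norm_add_sq_real, norm_smul, norm_smul, real_inner_smul_left,
      real_inner_smul_right, mul_pow, mul_pow, Real.norm_eq_abs, Real.norm_eq_abs, sq_abs, sq_abs]
    field_simp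
  unfold gap
  rw [e]
  simp only [lagr, inner_add_left, real_inner_smul_left] at h1 h2 h4
  linarith

theorem optVal_eq {u : EuclideanSpace ℝ (Fin n)} (hu : u ∈ P.solutions) : P.optVal = P.f u :=
  (IsLeast.csInf_eq ⟨⟨u, hu.1, rfl⟩, by rintro _ ⟨v, hv, rfl⟩; exact hu.2 v hv⟩)

theorem dual_le_optVal (hcl : IsClosed P.U) (hbdd : Bornology.IsBounded P.U)
    (hf : Differentiable ℝ P.f) (hsol : P.solutions.Nonempty) (ρ : ℝ)
    (x : EuclideanSpace ℝ (Fin m)) : P.dual ρ x ≤ P.optVal := by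
  obtain ⟨u, hu⟩ := hsol
  have h := P.dual_le_lagr hcl hbdd hf ρ x hu.1.1
  rw [P.optVal_eq hu]
  simpa [lagr, hu.1.2] using h

/-- A point with small smoothed gap is `ε`-optimal once the smoothing parameter is small. -/
theorem isEpsOptimal_of_gap_le (hcl : IsClosed P.U) (hbdd : Bornology.IsBounded P.U)
    (hf : Differentiable ℝ P.f) (hsol : P.solutions.Nonempty)
    {xstar : EuclideanSpace ℝ (Fin m)} (hmult : P.IsMultiplier xstar) {ε μ : ℝ} (hε : 0 < ε)
    (hμ : 0 < μ) (h4 : 4 * μ < ε) (hb : 4 * μ * ‖xstar‖ ≤ ε)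
    {u : EuclideanSpace ℝ (Fin n)} (hu : u ∈ P.U) (hgap : P.gap μ ρ u x ≤ ε) :
    P.IsEpsOptimal ε u := by
  have h1 := P.dual_le_optVal hcl hbdd hf hsol ρ x
  have h2 := P.dual_le_lagr hcl hbdd hf 0 xstar hu
  rw [show P.dual 0 xstar = P.optVal from hmult] at h2
  have h3 : 0 ≤ ‖P.resid u‖ ^ 2 / (2 * μ) := by positivity
  have h5 := real_inner_le_norm xstar (P.resid u)
  unfold gap at hgap
  simp only [lagr, zero_div, zero_mul, add_zero, sub_zero] at h2
  refine ⟨hu, by linarith, ?_⟩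
  -- If `R > ε`, then `2με < R²/2` and `2μ‖x*‖R < R²/2`, contradicting `R² ≤ 2μ(ε + ‖x*‖R)`.
  by_contra! hR
  set R := ‖P.resid u‖
  have h6 : R ^ 2 / (2 * μ) ≤ ε + ‖xstar‖ * R := by linarith
  rw [div_le_iff₀ (by positivity)] at h6
  have h7 := mul_le_mul_of_nonneg_right hb (by linarith : 0 ≤ R)
  have h8 : 4 * μ * ε < ε * ε := mul_lt_mul_of_pos_right h4 hε
  nlinarith

end Outer

end LinConstrProgram

/-! ### Parameters and invariants of the outer iteration -/

theorem ifalDelta_pos {ε : ℝ} (hε : 0 < ε) (k : ℕ) : 0 < ifalDelta ε k := by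
  unfold ifalDelta; positivity

/-- `δ_k` decreases in `k`, so `k = 0` is the worst case; there `(2D)² L / δ_0 = 24 D² L / ε`. -/
theorem one_le_of_le_diam {L D ε : ℝ} (hL : 0 < L) (hD : 0 ≤ D) (hε : 0 < ε)
    (h : ε ≤ 24 * D ^ 2 * L) (k : ℕ) : 1 ≤ 2 * D * √(L / ifalDelta ε k) := by
  have hk : (0 : ℝ) ≤ k := k.cast_nonneg
  have e : 2 * D * √(L / ifalDelta ε k) = √((2 * D) ^ 2 * (L / ifalDelta ε k)) := by
    rw [Real.sqrt_mul (sq_nonneg _), Real.sqrt_sq (by positivity)]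
  rw [e]
  refine Real.le_sqrt_of_sq_le ?_
  have := ifalDelta_pos hε k
  rw [mul_div_assoc', le_div_iff₀ this, ifalDelta, one_pow, one_mul, div_le_iff₀ (by positivity)]
  have : 0 ≤ D ^ 2 * L * k := by positivity
  nlinarith

namespace LinConstrProgram

variable {n m : ℕ} (P : LinConstrProgram n m) {Lf ρ : ℝ}

theorem ifal_μ (τ δ : ℕ → ℝ) (w : ℕ → EuclideanSpace ℝ (Fin n)) (s₀ : IFALState n m) (k : ℕ) :
    (P.ifal Lf ρ τ δ w s₀ (k + 1)).μ = (1 - τ k) * (P.ifal Lf ρ τ δ w s₀ k).μ := rfl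

/-- The factors `1 - τ_j = (j + 1) / (j + 3)` telescope. -/
theorem ifal_tau_μ (δ : ℕ → ℝ) (w : ℕ → EuclideanSpace ℝ (Fin n))
    (u₀ : EuclideanSpace ℝ (Fin n)) (x₀ : EuclideanSpace ℝ (Fin m)) (k : ℕ) :
    (P.ifal Lf ρ ifalTau δ w ⟨u₀, x₀, 4 / ρ⟩ k).μ = 8 / (ρ * ((k + 1) * (k + 2))) := by
  induction k with
  | zero =>
    simp only [ifal, Nat.cast_zero, zero_add, one_mul]
    rw [mul_comm, ← div_div]
    norm_num
  | succ k ih =>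
    have h1 : (k : ℝ) + 3 ≠ 0 := by positivity
    rw [ifal_μ, ih, ifalTau]
    rcases eq_or_ne ρ 0 with rfl | hρ
    · simp
    · push_cast
      field_simp
      ring

theorem ifal_mem (hcl : IsClosed P.U) (hconv : Convex ℝ P.U) (δ : ℕ → ℝ)
    {w : ℕ → EuclideanSpace ℝ (Fin n)} (hw : ∀ k, w k ∈ P.U) {s₀ : IFALState n m}
    (hu : s₀.u ∈ P.U) (k : ℕ) : (P.ifal Lf ρ ifalTau δ w s₀ k).u ∈ P.U := by
  induction k with
  | zero => exact hu
  | succ k ih =>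
    have hk : (0 : ℝ) ≤ k := k.cast_nonneg
    refine hconv ih (P.innerSol_mem hcl (hw k)) ?_ ?_ (by ring)
    · rw [ifalTau, sub_nonneg, div_le_one (by positivity)]
      linarith
    · unfold ifalTau
      positivity

/-- Along the IFAL method the smoothed gap stays below `ε`. -/
theorem gap_ifal_le (hcl : IsClosed P.U) (hconv : Convex ℝ P.U)
    (hbdd : Bornology.IsBounded P.U) (hc : ConvexOn ℝ Set.univ P.f) (hf : Differentiable ℝ P.f)
    (hρ : 0 < ρ) {ε : ℝ} (hε : 0 < ε) {w : ℕ → EuclideanSpace ℝ (Fin n)} (hw : ∀ k, w k ∈ P.U)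
    (u₀ : EuclideanSpace ℝ (Fin n)) (x₀ : EuclideanSpace ℝ (Fin m))
    (h₀ : P.smoothedGap (4 / ρ) ρ u₀ x₀ ≤ ifalDelta ε 0)
    (hin : ∀ k, P.ifalInnerError Lf ρ ifalTau (ifalDelta ε) w ⟨u₀, x₀, 4 / ρ⟩ k ≤ ifalDelta ε k)
    (k : ℕ) :
    P.gap (P.ifal Lf ρ ifalTau (ifalDelta ε) w ⟨u₀, x₀, 4 / ρ⟩ k).μ ρ
      (P.ifal Lf ρ ifalTau (ifalDelta ε) w ⟨u₀, x₀, 4 / ρ⟩ k).u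
      (P.ifal Lf ρ ifalTau (ifalDelta ε) w ⟨u₀, x₀, 4 / ρ⟩ k).x ≤ ε := by
  induction k with
  | zero =>
    refine (P.gap_le_smoothedGap (show 0 < 4 / ρ by positivity) _ _ _).trans (h₀.trans ?_)
    simp only [ifalDelta, Nat.cast_zero]
    linarith
  | succ k ih =>
    have hμ := P.ifal_tau_μ (Lf := Lf) (ρ := ρ) (ifalDelta ε) w u₀ x₀ k
    set s := P.ifal Lf ρ ifalTau (ifalDelta ε) w ⟨u₀, x₀, 4 / ρ⟩ k
    have hk : (0 : ℝ) ≤ k := k.cast_nonneg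
    have hμ0 : 0 < s.μ := by rw [hμ]; positivity
    have hτ1 : ifalTau k < 1 := by
      rw [ifalTau, div_lt_one (by positivity)]
      linarith
    have hτ0 : 0 ≤ ifalTau k := by unfold ifalTau; positivity
    have hstep : ifalTau k ^ 2 / (2 * ((1 - ifalTau k) * s.μ)) ≤ ρ / 4 := by
      have hpos : 0 < (1 - ifalTau k) * s.μ := mul_pos (by linarith) hμ0
      have e : ρ / 4 * (2 * ((1 - ifalTau k) * s.μ)) = 4 / ((k + 3) * (k + 2)) := by
        rw [hμ, ifalTau]
        field_simp
        ring
      rw [div_le_iff₀ (by positivity), e, ifalTau, div_pow]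
      norm_num
      gcongr
      nlinarith
    have h := P.gap_step_le hcl hconv hbdd hc hf hρ hμ0 hτ0 hτ1 hstep
      (P.innerSol_mem (Lf := Lf) (δ := ifalDelta ε k) hcl (hw k)) s.u (hin k)
    refine h.trans ?_
    have h1 := mul_le_mul_of_nonneg_left ih (by linarith : 0 ≤ 1 - ifalTau k)
    -- Here `3/2 ≤ 2` leaves room, and `(1 - τ)ε + τε = ε` closes the induction.
    have h2 : 3 * ifalDelta ε k ≤ ifalTau k * ε := by
      rw [ifalDelta, ifalTau, ← sub_nonneg]
      have : 2 / ((k : ℝ) + 3) * ε - 3 * (ε / (2 * (k + 3))) = ε / (2 * (k + 3)) := by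
        field_simp
        ring
      rw [this]
      positivity
    linarith

end LinConstrProgram

/-! ### Stopping index and total count -/

theorem le_ifalGamma_sq {ε ρ b : ℝ} (hε : 0 < ε) (hρ : 0 < ρ) (hb : 0 ≤ b) :
    ε / 3 ≤ ifalGamma ε ρ b ^ 2 ∧ 32 / ρ ≤ ifalGamma ε ρ b ^ 2 ∧ 8 * b / ρ ≤ ifalGamma ε ρ b ^ 2 := by
  have key : ∀ {a : ℝ}, 0 ≤ a → √a ≤ ifalGamma ε ρ b → a ≤ ifalGamma ε ρ b ^ 2 := fun ha h => by
    rw [← Real.sq_sqrt ha]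
    exact pow_le_pow_left₀ (Real.sqrt_nonneg _) h 2
  refine ⟨key (by positivity) (le_max_left _ _),
    key (by positivity) ((le_max_left _ _).trans (le_max_right _ _)), ?_⟩
  have h0 : 0 ≤ 2 * √(4 * ε / (3 * ρ)) := by positivity
  have := key (by positivity) ((le_max_right _ _).trans (le_max_right _ _))
  linarith

theorem ifalGamma_nonneg (ε ρ b : ℝ) : 0 ≤ ifalGamma ε ρ b :=
  (Real.sqrt_nonneg _).trans (le_max_left _ _)

theorem ifalGamma_mono {ε ε' ρ b : ℝ} (hρ : 0 < ρ) (h : ε ≤ ε') :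
    ifalGamma ε ρ b ≤ ifalGamma ε' ρ b := by
  unfold ifalGamma
  gcongr

/-- A stopping index of order `√q` whose square dominates `4 q`. -/
theorem exists_stopping_index {q : ℝ} (hq : 1 / 3 ≤ q) :
    ∃ K : ℕ, 4 * q ≤ ((K : ℝ) + 1) * (K + 2) ∧
      ((K : ℝ) + 1) ^ 4 * (K + 3) ^ 2 ≤ 4096 * q ^ 3 := by
  classical
  have hex : ∃ K : ℕ, 4 * q ≤ ((K : ℝ) + 1) * (K + 2) := by
    obtain ⟨K, hK⟩ := exists_nat_ge (4 * q)
    exact ⟨K, by nlinarith⟩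
  refine ⟨Nat.find hex, Nat.find_spec hex, ?_⟩
  have hq3 : (1 / 3 : ℝ) ^ 3 ≤ q ^ 3 := by gcongr
  -- For index `0` the claim is `9 ≤ 4096 q³`, the reason for `1/3 ≤ q`. Otherwise minimality gives
  -- `(K+1)(K+2) < 4q` at the predecessor.
  rcases hK : Nat.find hex with _ | K
  · norm_num at hq3 ⊢
    linarith
  · have hlt : ¬ 4 * q ≤ ((K : ℝ) + 1) * (K + 2) :=
      Nat.find_min hex (by rw [hK]; exact K.lt_succ_self)
    have hk : (0 : ℝ) ≤ K := K.cast_nonneg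
    have h3 : (((K : ℝ) + 1) * (K + 2)) ^ 3 ≤ (4 * q) ^ 3 :=
      pow_le_pow_left₀ (by positivity) (not_le.1 hlt).le 3
    push_cast
    have h4 : ((K : ℝ) + 2) * (K + 4) ^ 2 ≤ 64 * (K + 1) ^ 3 := by
      have h0 : 0 ≤ (K : ℝ) ^ 2 := by positivity
      have h1 : 0 ≤ (K : ℝ) ^ 3 := by positivity
      nlinarith
    have h5 := mul_le_mul_of_nonneg_left h4 (by positivity : 0 ≤ ((K : ℝ) + 2) ^ 3)
    nlinarith

/-- The sum of the inner complexities up to `K` in terms of the fourth power of the bound. -/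
theorem sum_inner_bound_le {ε γ D L : ℝ} (hε : 0 < ε) (hγ : 0 ≤ γ) (hD : 0 ≤ D) (hL : 0 < L)
    {K : ℕ} (hK : ((K : ℝ) + 1) ^ 4 * (K + 3) ^ 2 ≤ 4096 * (γ ^ 2 / ε) ^ 3) :
    ∑ k ∈ Finset.range (K + 1), 2 * D * √(L / ifalDelta ε k)
      ≤ 16 * γ ^ (3 / 2 : ℝ) * D * √(2 * L) / ε ^ (5 / 4 : ℝ) := by
  have hterm : ∀ k ∈ Finset.range (K + 1),
      2 * D * √(L / ifalDelta ε k) ≤ 2 * D * (√(2 * L) / √ε * √((K : ℝ) + 3)) := by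
    intro k hk
    have hk' : (k : ℝ) ≤ K := by exact_mod_cast Nat.lt_succ_iff.1 (Finset.mem_range.1 hk)
    have e : L / ifalDelta ε k = 2 * L / ε * (k + 3) := by
      rw [ifalDelta]
      field_simp
    rw [e, Real.sqrt_mul (by positivity), Real.sqrt_div (by positivity)]
    gcongr
  refine (Finset.sum_le_sum hterm).trans ?_
  rw [Finset.sum_const, Finset.card_range, nsmul_eq_mul]
  -- All terms are bounded by the last one; the fourth power of this inequality is `hK`, with `4096
  -- = 8⁴`.
  have hmain : ((K : ℝ) + 1) * √((K : ℝ) + 3) ≤ 8 * γ ^ (3 / 2 : ℝ) / ε ^ (3 / 4 : ℝ) := by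
    refine (pow_le_pow_iff_left₀ (by positivity) (by positivity) (by norm_num : (4 : ℕ) ≠ 0)).1 ?_
    have e1 : √((K : ℝ) + 3) ^ 4 = ((K : ℝ) + 3) ^ 2 := by
      rw [show 4 = 2 * 2 from rfl, pow_mul, Real.sq_sqrt (by positivity)]
    have e2 : (γ ^ (3 / 2 : ℝ)) ^ 4 = γ ^ 6 := by
      rw [← Real.rpow_natCast, ← Real.rpow_mul hγ, ← Real.rpow_natCast]
      norm_num
    have e3 : (ε ^ (3 / 4 : ℝ)) ^ 4 = ε ^ 3 := by
      rw [← Real.rpow_natCast, ← Real.rpow_mul hε.le, ← Real.rpow_natCast]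
      norm_num
    rw [mul_pow, div_pow, mul_pow, e1, e2, e3]
    refine hK.trans (le_of_eq ?_)
    rw [div_pow]
    ring
  have e4 : ε ^ (5 / 4 : ℝ) = √ε * ε ^ (3 / 4 : ℝ) := by
    rw [Real.sqrt_eq_rpow, ← Real.rpow_add hε]
    norm_num
  have h := mul_le_mul_of_nonneg_left hmain
    (by positivity : 0 ≤ 2 * D * (√(2 * L) / √ε))
  refine le_of_eq_of_le ?_ (h.trans_eq ?_)
  · push_cast
    ring
  · rw [e4]
    field_simp
    ring

/-- For small `ε` the IFAL method finds an `ε`-optimal point with `O(ε ^ (-5/4))` projections. -/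
theorem LinConstrProgram.ifal_complexity {n m : ℕ} (P : LinConstrProgram n m) {Lf ρ : ℝ}
    {xstar : EuclideanSpace ℝ (Fin m)}
    (hcl : IsClosed P.U) (hconv : Convex ℝ P.U) (hbdd : Bornology.IsBounded P.U)
    (hsol : P.solutions.Nonempty) (hmult : P.IsMultiplier xstar)
    (hc : ConvexOn ℝ Set.univ P.f) (hf : Differentiable ℝ P.f) (hLf : 0 < Lf)
    (hL : ∀ u v, ‖gradient P.f u - gradient P.f v‖ ≤ Lf * ‖u - v‖) (hρ : 0 < ρ)
    {ε : ℝ} (hε : 0 < ε) (hεD : ε ≤ 24 * Metric.diam P.U ^ 2 * (Lf + ρ * ‖P.G‖ ^ 2))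
    {u₀ : EuclideanSpace ℝ (Fin n)} (hu₀ : u₀ ∈ P.U) (x₀ : EuclideanSpace ℝ (Fin m))
    {w : ℕ → EuclideanSpace ℝ (Fin n)} (hw : ∀ k, w k ∈ P.U)
    (h₀ : P.smoothedGap (4 / ρ) ρ u₀ x₀ ≤ ifalDelta ε 0) :
    (∀ k, P.ifalInnerError Lf ρ ifalTau (ifalDelta ε) w ⟨u₀, x₀, 4 / ρ⟩ k ≤ ifalDelta ε k) ∧
      ∃ K : ℕ,
        P.IsEpsOptimal ε (P.ifal Lf ρ ifalTau (ifalDelta ε) w ⟨u₀, x₀, 4 / ρ⟩ K).u ∧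
        ((∑ k ∈ Finset.range (K + 1),
            P.ifalCount Lf ρ ifalTau (ifalDelta ε) w ⟨u₀, x₀, 4 / ρ⟩ k : ℕ) : ℝ) ≤
          16 * ifalGamma ε ρ ‖xstar‖ ^ (3 / 2 : ℝ) * Metric.diam P.U *
              √(2 * (Lf + ρ * ‖P.G‖ ^ 2)) / ε ^ (5 / 4 : ℝ) := by
  have hLpos : 0 < Lf + ρ * ‖P.G‖ ^ 2 := by positivity
  have hinner := fun k => P.innerSol_error_le_and_innerCount_le
    (x := P.xhat (ifalTau k) (P.ifal Lf ρ ifalTau (ifalDelta ε) w ⟨u₀, x₀, 4 / ρ⟩ k))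
    hcl hconv hbdd hc hf hLf hL hρ
    (ifalDelta_pos hε k) (hw k) (one_le_of_le_diam hLpos Metric.diam_nonneg hε hεD k)
  refine ⟨fun k => (hinner k).1, ?_⟩
  obtain ⟨hg1, hg2, hg3⟩ := le_ifalGamma_sq hε hρ (norm_nonneg xstar)
  set γ := ifalGamma ε ρ ‖xstar‖
  -- Each entry of `γ` has its role: `ε/3` serves the stopping index, `32/ρ` gives `4μ < ε`, and
  -- `8‖x*‖/ρ` gives `4μ‖x*‖ ≤ ε`.
  have hq : 1 / 3 ≤ γ ^ 2 / ε := by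
    rw [le_div_iff₀ hε]
    linarith
  obtain ⟨K, hK1, hK2⟩ := exists_stopping_index hq
  refine ⟨K, ?_, ?_⟩
  · have hμ := P.ifal_tau_μ (Lf := Lf) (ρ := ρ) (ifalDelta ε) w u₀ x₀ K
    have hM : 4 * γ ^ 2 ≤ ε * (((K : ℝ) + 1) * (K + 2)) := by
      rw [mul_div_assoc', div_le_iff₀ hε] at hK1
      linarith
    rw [div_le_iff₀ hρ] at hg2 hg3
    have hM' := mul_le_mul_of_nonneg_right hM hρ.le
    refine P.isEpsOptimal_of_gap_le hcl hbdd hf hsol hmult hε (by rw [hμ]; positivity) ?_ ?_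
      (P.ifal_mem hcl hconv _ hw hu₀ K)
      (P.gap_ifal_le hcl hconv hbdd hc hf hρ hε hw u₀ x₀ h₀ (fun k => (hinner k).1) K)
    · rw [hμ, mul_div_assoc', div_lt_iff₀ (by positivity)]
      linarith
    · rw [hμ, mul_div_assoc', div_mul_eq_mul_div, div_le_iff₀ (by positivity)]
      linarith
  · push_cast
    exact (Finset.sum_le_sum fun k _ => (hinner k).2).trans
      (sum_inner_bound_le hε (ifalGamma_nonneg _ _ _) Metric.diam_nonneg hLpos hK2)

/-- If `U` has diameter zero, the starting point is optimal and no projection is needed. -/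
theorem LinConstrProgram.ifal_of_diam_eq_zero {n m : ℕ} (P : LinConstrProgram n m) {Lf ρ : ℝ}
    (hbdd : Bornology.IsBounded P.U) (hsol : P.solutions.Nonempty)
    (hD : Metric.diam P.U = 0) {ε : ℝ} (hε : 0 < ε)
    {u₀ : EuclideanSpace ℝ (Fin n)} (hu₀ : u₀ ∈ P.U) (x₀ : EuclideanSpace ℝ (Fin m))
    {w : ℕ → EuclideanSpace ℝ (Fin n)} (hw : ∀ k, w k ∈ P.U) :
    P.IsEpsOptimal ε (P.ifal Lf ρ ifalTau (ifalDelta ε) w ⟨u₀, x₀, 4 / ρ⟩ 0).u ∧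
      ∑ k ∈ Finset.range (0 + 1),
        P.ifalCount Lf ρ ifalTau (ifalDelta ε) w ⟨u₀, x₀, 4 / ρ⟩ k = 0 := by
  have hsub : ∀ {u v}, u ∈ P.U → v ∈ P.U → u = v := fun hu hv =>
    dist_le_zero.1 (hD ▸ Metric.dist_le_diam_of_mem hbdd hu hv)
  constructor
  · obtain ⟨us, hus⟩ := hsol
    obtain rfl : u₀ = us := hsub hu₀ hus.1.1
    refine ⟨hu₀, ?_, ?_⟩
    · rw [P.optVal_eq hus]
      simpa [ifal] using hε.le
    · simpa [ifal, hus.1.2] using hε.le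
  · rw [zero_add, Finset.sum_range_one]
    refine Nat.sInf_eq_zero.2 (Or.inl ?_)
    have hδ := ifalDelta_pos hε 0
    set x := P.xhat (ifalTau 0) (P.ifal Lf ρ ifalTau (ifalDelta ε) w ⟨u₀, x₀, 4 / ρ⟩ 0)
    have h := P.le_dual ρ x (c := P.lagr 0 ρ (w 0) x) ⟨w 0, hw 0⟩
      fun u hu => by rw [hsub hu (hw 0)]
    have e : P.innerIter Lf ρ x (w 0) 0 = w 0 := rfl
    simp only [Set.mem_ofPred_eq, e]
    linarith

theorem mainTheorem2 {n m : ℕ} (P : LinConstrProgram n m) (Lf ρ : ℝ)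
    (xstar : EuclideanSpace ℝ (Fin m))
    (hUclosed : IsClosed P.U) (hUconvex : Convex ℝ P.U) (hUbdd : Bornology.IsBounded P.U)
    (hsol : P.solutions.Nonempty)
    (hmult : P.IsMultiplier xstar)
    (hfconvex : ConvexOn ℝ Set.univ P.f) (hfdiff : Differentiable ℝ P.f)
    (hLf : 0 < Lf)
    (hfLip : ∀ u v, ‖gradient P.f u - gradient P.f v‖ ≤ Lf * ‖u - v‖)
    (hρ : 0 < ρ) :
    (∀ ε : ℝ, 0 < ε → ε ≤ 24 * Metric.diam P.U ^ 2 * (Lf + ρ * ‖P.G‖ ^ 2) →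
      ∀ u₀ ∈ P.U, ∀ x₀ : EuclideanSpace ℝ (Fin m),
      ∀ w : ℕ → EuclideanSpace ℝ (Fin n), (∀ k, w k ∈ P.U) →
      P.smoothedGap (4 / ρ) ρ u₀ x₀ ≤ ifalDelta ε 0 →
      (∀ k, P.ifalInnerError Lf ρ ifalTau (ifalDelta ε) w ⟨u₀, x₀, 4 / ρ⟩ k ≤ ifalDelta ε k) ∧
      ∃ K : ℕ,
        P.IsEpsOptimal ε (P.ifal Lf ρ ifalTau (ifalDelta ε) w ⟨u₀, x₀, 4 / ρ⟩ K).u ∧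
        ∑ k ∈ Finset.range (K + 1),
            P.ifalCount Lf ρ ifalTau (ifalDelta ε) w ⟨u₀, x₀, 4 / ρ⟩ k ≤
          ⌊16 * ifalGamma ε ρ ‖xstar‖ ^ (3 / 2 : ℝ) * Metric.diam P.U *
              √(2 * (Lf + ρ * ‖P.G‖ ^ 2)) / ε ^ (5 / 4 : ℝ)⌋₊) ∧
    (∃ C : ℝ, ∀ᶠ ε in 𝓝[>] (0 : ℝ),
      ∀ u₀ ∈ P.U, ∀ x₀ : EuclideanSpace ℝ (Fin m),
      ∀ w : ℕ → EuclideanSpace ℝ (Fin n), (∀ k, w k ∈ P.U) →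
      P.smoothedGap (4 / ρ) ρ u₀ x₀ ≤ ifalDelta ε 0 →
      ∃ K : ℕ,
        P.IsEpsOptimal ε (P.ifal Lf ρ ifalTau (ifalDelta ε) w ⟨u₀, x₀, 4 / ρ⟩ K).u ∧
        ((∑ k ∈ Finset.range (K + 1),
            P.ifalCount Lf ρ ifalTau (ifalDelta ε) w ⟨u₀, x₀, 4 / ρ⟩ k : ℕ) : ℝ) ≤
          C * ε ^ (-(5 / 4) : ℝ)) := by
  have hLpos : 0 < Lf + ρ * ‖P.G‖ ^ 2 := by positivity
  refine ⟨fun ε hε hεD u₀ hu₀ x₀ w hw h₀ => ?_, ?_⟩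
  · obtain ⟨h1, K, h2, h3⟩ := P.ifal_complexity hUclosed hUconvex hUbdd hsol hmult hfconvex hfdiff
      hLf hfLip hρ hε hεD hu₀ x₀ hw h₀
    exact ⟨h1, K, h2, Nat.le_floor h3⟩
  -- For diameter zero no `ε > 0` meets the bound `ε ≤ 24 D² L`, so this case is separate, with `C =
  -- 0`.
  · rcases Metric.diam_nonneg (s := P.U).eq_or_lt with hD | hD
    · refine ⟨0, ?_⟩
      filter_upwards [self_mem_nhdsWithin] with ε hε u₀ hu₀ x₀ w hw _
      obtain ⟨h1, h2⟩ := P.ifal_of_diam_eq_zero (Lf := Lf) (ρ := ρ) hUbdd hsol hD.symm hε hu₀ x₀ hw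
      exact ⟨0, h1, by rw [h2]; simp⟩
    -- `γ` grows with `ε`, so its value at `1` serves all `ε ≤ 1`.
    · refine ⟨16 * ifalGamma 1 ρ ‖xstar‖ ^ (3 / 2 : ℝ) * Metric.diam P.U *
        √(2 * (Lf + ρ * ‖P.G‖ ^ 2)), ?_⟩
      have hpos : 0 < min 1 (24 * Metric.diam P.U ^ 2 * (Lf + ρ * ‖P.G‖ ^ 2)) := by positivity
      filter_upwards [Ioc_mem_nhdsGT hpos] with ε hε u₀ hu₀ x₀ w hw h₀
      obtain ⟨_, K, h2, h3⟩ := P.ifal_complexity hUclosed hUconvex hUbdd hsol hmult hfconvex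
        hfdiff hLf hfLip hρ hε.1 (hε.2.trans (min_le_right _ _)) hu₀ x₀ hw h₀
      refine ⟨K, h2, h3.trans ?_⟩
      have hε0 : 0 ≤ ε := hε.1.le
      have hγ0 := ifalGamma_nonneg ε ρ ‖xstar‖
      have hγ : ifalGamma ε ρ ‖xstar‖ ≤ ifalGamma 1 ρ ‖xstar‖ :=
        ifalGamma_mono hρ (hε.2.trans (min_le_left _ _))
      rw [Real.rpow_neg hε0, div_eq_mul_inv]
      gcongr
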